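/- Let $n\ge 1$, let $p\in(0,n)$, let $\Omega\subset\mathbb R^n$ be a bounded convex domain (open set), and let $\nu$ be a Borel measure on $\Omega$. Assume that either (i) $\nu=f\,d\mathcal L^n$, where $\mathcal L^n$ is Lebesgue measure, $f\in C(\overline\Omega)$ and $f>0$ on $\overline\Omega$; or (ii) $\nu$ is compactly supported in $\Omega$, that is, $\nu(\Omega\setminus K)=0$ for some compact set $K\subset\Omega$. For a convex function $w:\Omega\to\mathbb R$, let $$\partial w(x)=\{q\in\mathbb R^n: w(y)\ge w(x)+q\cdot(y-x)\ \text{for all } y\in\Omega\}$$ be its subdifferential at $x\in\Omega$, and let $\mu_w$ be its Monge–Ampère measure, $\mu_w(S)=\mathcal L^n\big(\bigcup_{x\in S}\partial w(x)\big)$ for every Borel set $S\subset\Omega$. Inequalities between Borel measures on $\Omega$ mean inequality on every Borel subset of $\Omega$, and $|w|^p\nu$ is the measure $S\mapsto\int_S|w|^p\,d\nu$. Let $u,v\in C(\overline\Omega)$ be convex functions such that - $v<0$ in $\Omega$, $v\le 0$ on $\partial\Omega$, and $\mu_v\ge |v|^p\nu$ in $\Omega$; - $u=0$ on $\partial\Omega$,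 and $\mu_u\le |u|^p\nu$ in $\Omega$. Then $u\ge v$ in $\Omega$, and consequently $\mu_u\le\mu_v$ in $\Omega$. -/

import Mathlib

open MeasureTheory

/-- The subdifferential `∂u(x)` of a function `u` on `Ω ⊆ ℝⁿ` at the point `x`: all slopes `q` with
`u y ≥ u x + q · (y - x)` for every `y ∈ Ω`. -/
def subdifferential {n : ℕ} (Ω : Set (EuclideanSpace ℝ (Fin n)))
    (u : EuclideanSpace ℝ (Fin n) → ℝ) (x : EuclideanSpace ℝ (Fin n)) :
    Set (EuclideanSpace ℝ (Fin n)) :=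
  {q | ∀ y ∈ Ω, u x + inner ℝ q (y - x) ≤ u y}

/-- The value `μ_u(S) = |∂u(S)|`, `∂u(S) = ⋃ x ∈ S, ∂u(x)`, of the Monge–Ampère measure of the
convex function `u` on `Ω`, on a Borel set `S ⊆ Ω`. It is only used on such sets. -/
noncomputable def mongeAmpere {n : ℕ} (Ω : Set (EuclideanSpace ℝ (Fin n)))
    (u : EuclideanSpace ℝ (Fin n) → ℝ) (S : Set (EuclideanSpace ℝ (Fin n))) : ENNReal :=
  volume (⋃ x ∈ S, subdifferential Ω u x)

/-- The value `∫_S |u|^p dν` of the measure `|u|^p ν` on a Borel set `S`. -/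
noncomputable def powMeasure {n : ℕ} (ν : Measure (EuclideanSpace ℝ (Fin n))) (p : ℝ)
    (u : EuclideanSpace ℝ (Fin n) → ℝ) (S : Set (EuclideanSpace ℝ (Fin n))) : ENNReal :=
  ∫⁻ x in S, ENNReal.ofReal (|u x| ^ p) ∂ν

/-- The inequality `α ≤ β` in `Ω` between Borel measures on `Ω`, given by their values on the Borel
subsets of `Ω`. -/
def BorelLE {n : ℕ} (Ω : Set (EuclideanSpace ℝ (Fin n)))
    (α β : Set (EuclideanSpace ℝ (Fin n)) → ENNReal) : Prop :=
  ∀ S : Set (EuclideanSpace ℝ (Fin n)), MeasurableSet S → S ⊆ Ω → α S ≤ β S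

/-- On `Ω`, `ν` is `f` times Lebesgue measure, with `f` continuous and positive on the closure. -/
def HasPositiveContinuousDensity {n : ℕ} (Ω : Set (EuclideanSpace ℝ (Fin n)))
    (ν : Measure (EuclideanSpace ℝ (Fin n))) : Prop :=
  ∃ f : EuclideanSpace ℝ (Fin n) → ℝ, ContinuousOn f (closure Ω) ∧ (∀ x ∈ closure Ω, 0 < f x) ∧
    ν.restrict Ω = (volume.restrict Ω).withDensity fun x => ENNReal.ofReal (f x)

/-- As a measure on `Ω`, `ν` is concentrated on a compact subset of `Ω`. -/
def IsCompactlySupportedIn {n : ℕ} (Ω : Set (EuclideanSpace ℝ (Fin n)))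
    (ν : Measure (EuclideanSpace ℝ (Fin n))) : Prop :=
  ∃ K : Set (EuclideanSpace ℝ (Fin n)), IsCompact K ∧ K ⊆ Ω ∧ ν (Ω \ K) = 0

/-! The two sides scale differently: `v ↦ s v` multiplies `μ_v` by `s ^ n` but `|v|^p ν` only by `s
^ p`, and `p < n`. If `t v ≤ u` holds ν-a.e., then `μ_u ≤ t ^ p μ_v = (t ^ p / s ^ n) μ_{sv}`. When
`t ^ p < s ^ n`, comparison with a factor below one (`le_of_mongeAmpere_le_mul`) gives `s v ≤ u`
everywhere. So any `t > 1` can be lowered, and the infimum of admissible factors at least `τ` is `τ`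
itself, for each `τ > 1` (`mul_le_of_exists_ae_mul_le`); then `τ → 1`.

The argument needs one admissible `t` to start. For compactly supported `ν`, `u / v` is bounded on
the support. For a density, `v` may vanish on the boundary, so `u` is replaced by its contraction `u
(x₀ + r (x - x₀))`, `r > 1`, on a domain whose closure lies in `Ω`. This costs a factor `A` that
tends to 1 with `r`, whence the condition `A < τ ^ (n - p)`; the conclusion is read off at the fixed
point `x₀`. -/

/-! ### Convex functions up to the boundary -/

open Set Filter Topology in
/-- A convex function that is continuous on the closure of its domain is convex there. -/
lemma ConvexOn.closure_of_continuousOn {n : ℕ} {Ω : Set (EuclideanSpace ℝ (Fin n))}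
    {u : EuclideanSpace ℝ (Fin n) → ℝ} (hu : ConvexOn ℝ Ω u) (hc : ContinuousOn u (closure Ω)) :
    ConvexOn ℝ (closure Ω) u := by
  refine ⟨hu.1.closure, fun x hx y hy a b ha hb hab => ?_⟩
  obtain ⟨xs, hxs, hxl⟩ := mem_closure_iff_seq_limit.1 hx
  obtain ⟨ys, hys, hyl⟩ := mem_closure_iff_seq_limit.1 hy
  have lim : ∀ {zs : ℕ → EuclideanSpace ℝ (Fin n)} {z}, (∀ k, zs k ∈ Ω) →
      Tendsto zs atTop (𝓝 z) → Tendsto (fun k => u (zs k)) atTop (𝓝 (u z)) := by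
    intro zs z hz hl
    have hzc : z ∈ closure Ω := mem_closure_of_tendsto hl (Eventually.of_forall hz)
    exact (hc z hzc).tendsto.comp (tendsto_nhdsWithin_iff.2
      ⟨hl, Eventually.of_forall fun k => subset_closure (hz k)⟩)
  refine le_of_tendsto_of_tendsto'
    (lim (fun k => hu.1 (hxs k) (hys k) ha hb hab) ((hxl.const_smul a).add (hyl.const_smul b)))
    (((lim hxs hxl).const_mul a).add ((lim hys hyl).const_mul b)) fun k => ?_
  exact hu.2 (hxs k) (hys k) ha hb hab

open Set in
/-- From a point of a bounded open set, every ray meets the boundary. -/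
lemma exists_pos_add_smul_mem_frontier {n : ℕ} {Ω : Set (EuclideanSpace ℝ (Fin n))}
    (ho : IsOpen Ω) (hb : Bornology.IsBounded Ω) {x e : EuclideanSpace ℝ (Fin n)} (hx : x ∈ Ω)
    (he : e ≠ 0) : ∃ s : ℝ, 0 < s ∧ x + s • e ∈ frontier Ω := by
  obtain ⟨R, hR⟩ := hb.subset_closedBall x
  have hout : x + ((|R| + 1) / ‖e‖) • e ∉ Ω := by
    intro h
    have h1 := hR h
    rw [Metric.mem_closedBall, dist_eq_norm, add_sub_cancel_left, norm_smul, Real.norm_eq_abs,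
      abs_of_nonneg (by positivity), div_mul_cancel₀ _ (norm_ne_zero_iff.2 he)] at h1
    linarith [le_abs_self R]
  obtain ⟨y, hy, hyf⟩ : ∃ y ∈ segment ℝ x (x + ((|R| + 1) / ‖e‖) • e), y ∈ frontier Ω := by
    by_contra! hno
    have hdich : ∀ y ∈ segment ℝ x (x + ((|R| + 1) / ‖e‖) • e), y ∉ Ω → y ∈ (closure Ω)ᶜ :=
      fun y hy hyΩ hyc => hno y hy (by rw [ho.frontier_eq]; exact ⟨hyc, hyΩ⟩)
    obtain ⟨y, -, hy, hyc⟩ := (convex_segment (𝕜 := ℝ) x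
      (x + ((|R| + 1) / ‖e‖) • e)).isPreconnected Ω (closure Ω)ᶜ ho isClosed_closure.isOpen_compl
      (fun y hy => or_iff_not_imp_left.2 (hdich y hy)) ⟨x, left_mem_segment _ _ _, hx⟩
      ⟨_, right_mem_segment _ _ _, hdich _ (right_mem_segment _ _ _) hout⟩
    exact hyc (subset_closure hy)
  rw [segment_eq_image'] at hy
  obtain ⟨θ, hθ, rfl⟩ := hy
  simp only [add_sub_cancel_left, smul_smul] at hyf
  refine ⟨_, lt_of_le_of_ne (mul_nonneg hθ.1 (by positivity)) fun h0 => ?_, hyf⟩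
  rw [← h0, zero_smul, add_zero, ho.frontier_eq] at hyf
  exact hyf.2 hx

/-- A convex function with zero boundary values on a bounded open set is nonpositive. -/
lemma ConvexOn.nonpos_of_frontier {n : ℕ} (hn : n ≠ 0) {Ω : Set (EuclideanSpace ℝ (Fin n))}
    (ho : IsOpen Ω) (hb : Bornology.IsBounded Ω) {u : EuclideanSpace ℝ (Fin n) → ℝ}
    (hu : ConvexOn ℝ (closure Ω) u) (h0 : ∀ x ∈ frontier Ω, u x = 0) : ∀ x ∈ Ω, u x ≤ 0 := by
  intro x hx
  have : Nonempty (Fin n) := ⟨⟨0, Nat.pos_of_ne_zero hn⟩⟩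
  obtain ⟨e, he⟩ := exists_ne (0 : EuclideanSpace ℝ (Fin n))
  obtain ⟨s, hs, hsf⟩ := exists_pos_add_smul_mem_frontier ho hb hx he
  obtain ⟨t, ht, htf⟩ := exists_pos_add_smul_mem_frontier ho hb hx (neg_ne_zero.2 he)
  have hseg : x ∈ segment ℝ (x + s • e) (x + t • -e) := by
    refine ⟨t / (s + t), s / (s + t), by positivity, by positivity, by field_simp; ring, ?_⟩
    have h1 : t / (s + t) + s / (s + t) = 1 := by field_simp; ring
    have h2 : t / (s + t) * s = s / (s + t) * t := by ring
    calc (t / (s + t)) • (x + s • e) + (s / (s + t)) • (x + t • -e)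
        = (t / (s + t) + s / (s + t)) • x + (t / (s + t) * s) • e - (s / (s + t) * t) • e := by
          module
      _ = x := by rw [h1, h2, one_smul, add_sub_cancel_right]
  have := hu.le_on_segment (frontier_subset_closure hsf) (frontier_subset_closure htf) hseg
  rwa [h0 _ hsf, h0 _ htf, max_self] at this

/-! ### Subgradients and the comparison principle -/

lemma subdifferential_le_of_mem_closure {n : ℕ} {Ω : Set (EuclideanSpace ℝ (Fin n))}
    {v : EuclideanSpace ℝ (Fin n) → ℝ} (hv : ContinuousOn v (closure Ω))
    {x q y : EuclideanSpace ℝ (Fin n)} (hq : q ∈ subdifferential Ω v x) (hy : y ∈ closure Ω) :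
    v x + inner ℝ q (y - x) ≤ v y := by
  refine ContinuousWithinAt.closure_le (f := fun y => v x + inner ℝ q (y - x)) hy ?_
    ((hv y hy).mono subset_closure) hq
  exact (by fun_prop : Continuous fun y => v x + inner ℝ q (y - x)).continuousWithinAt

/-- If an affine function of slope `q` lies strictly below `w` and passes at height `u x + δ` over
`x`, then `q` is a subgradient of `u` at a point where `u + δ < w`. -/
lemma exists_mem_subdifferential_of_affine_lt {n : ℕ} {Ω : Set (EuclideanSpace ℝ (Fin n))}
    (ho : IsOpen Ω) (hb : Bornology.IsBounded Ω) {u w : EuclideanSpace ℝ (Fin n) → ℝ}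
    (hu : ContinuousOn u (closure Ω)) (hf : ∀ y ∈ frontier Ω, w y ≤ u y)
    {x q : EuclideanSpace ℝ (Fin n)} {δ : ℝ} (hδ : 0 ≤ δ) (hx : x ∈ Ω)
    (h : ∀ y ∈ closure Ω, u x + δ + inner ℝ q (y - x) < w y) :
    ∃ y ∈ Ω, u y + δ < w y ∧ q ∈ subdifferential Ω u y := by
  -- Sliding the plane of slope `q` until it touches `u` from below; the contact point cannot lie on
  -- the frontier, where `w ≤ u`.
  obtain ⟨y, hy, hmin⟩ := hb.isCompact_closure.exists_isMinOn ⟨x, subset_closure hx⟩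
    (f := fun y => u y - inner ℝ q y) (hu.sub (by fun_prop))
  have hmin' : ∀ z ∈ closure Ω, u y - inner ℝ q y ≤ u z - inner ℝ q z := hmin
  have h1 := hmin' x (subset_closure hx)
  have h2 := h y hy
  rw [inner_sub_right] at h2
  have h3 : u y + δ < w y := by linarith
  have hyΩ : y ∈ Ω := by
    by_contra hn
    have := hf y (by rw [ho.frontier_eq]; exact ⟨hy, hn⟩)
    linarith
  refine ⟨y, hyΩ, h3, fun z hz => ?_⟩
  have h4 := hmin' z (subset_closure hz)
  rw [inner_sub_right]
  linarith

open Set in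
/-- The subgradients of a bounded function over a compact subset of `Ω` form a bounded set. -/
lemma mongeAmpere_lt_top {n : ℕ} {Ω K U : Set (EuclideanSpace ℝ (Fin n))}
    (ho : IsOpen Ω) (hb : Bornology.IsBounded Ω) {u : EuclideanSpace ℝ (Fin n) → ℝ}
    (hu : ContinuousOn u (closure Ω)) (hK : IsCompact K) (hKΩ : K ⊆ Ω) (hU : U ⊆ K) :
    mongeAmpere Ω u U < ⊤ := by
  obtain ⟨r, hr, hrΩ⟩ := hK.exists_cthickening_subset_open ho hKΩ
  obtain ⟨M, hM⟩ := hb.isCompact_closure.exists_bound_of_continuousOn hu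
  refine (Metric.isBounded_closedBall (x := (0 : EuclideanSpace ℝ (Fin n)))
    (r := 2 * M / r)).subset ?_ |>.measure_lt_top
  refine iUnion₂_subset fun x hx q hq => ?_
  rw [mem_closedBall_zero_iff]
  have hMx := (abs_le.1 (hM x (subset_closure (hKΩ (hU hx)))))
  rcases eq_or_ne q 0 with rfl | hq0
  · rw [norm_zero]
    have : 0 ≤ M := (norm_nonneg _).trans (hM x (subset_closure (hKΩ (hU hx))))
    positivity
  have hqn : 0 < ‖q‖ := norm_pos_iff.2 hq0
  -- A step of length `r` along `q` stays in `Ω` and raises the supporting plane by `‖q‖ * r`, at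
  -- most the oscillation `2 * M`.
  have hy : x + (r / ‖q‖) • q ∈ Ω := by
    refine hrΩ (Metric.mem_cthickening_of_dist_le _ x _ _ (hU hx) ?_)
    rw [dist_eq_norm, add_sub_cancel_left, norm_smul, Real.norm_eq_abs,
      abs_of_pos (by positivity), div_mul_cancel₀ _ hqn.ne']
  have h1 := hq _ hy
  have h2 := (abs_le.1 (hM _ (subset_closure hy)))
  rw [add_sub_cancel_left, inner_smul_right, real_inner_self_eq_norm_sq] at h1
  have h3 : r / ‖q‖ * ‖q‖ ^ 2 = ‖q‖ * r := by field_simp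
  rw [le_div_iff₀ hr]
  linarith [h2.2, hMx.1]

open Set in
/-- The slopes near that of an affine function separating `u` from `v` fill up a ball. -/
lemma mongeAmpere_pos_of_lt {n : ℕ} {Ω : Set (EuclideanSpace ℝ (Fin n))}
    (ho : IsOpen Ω) (hb : Bornology.IsBounded Ω) {u v : EuclideanSpace ℝ (Fin n) → ℝ}
    (hu : ContinuousOn u (closure Ω)) (hv : ContinuousOn v (closure Ω))
    (hvc : ConvexOn ℝ (closure Ω) v) (hf : ∀ y ∈ frontier Ω, v y ≤ u y)
    {x : EuclideanSpace ℝ (Fin n)} {δ : ℝ} (hδ : 0 ≤ δ) (hx : x ∈ Ω) (h : u x + δ < v x) :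
    0 < mongeAmpere Ω u {y ∈ Ω | u y + δ < v y} := by
  obtain ⟨a, ha1, ha2⟩ := exists_between h
  obtain ⟨l, c, hl, hlx⟩ := hvc.exists_affine_le_of_lt (𝕜 := ℝ) (subset_closure hx) ha2
    isClosed_closure hv.lowerSemicontinuousOn
  obtain ⟨D, hD⟩ := hb.closure.subset_closedBall x
  set q₀ := (InnerProductSpace.toDual ℝ (EuclideanSpace ℝ (Fin n))).symm l
  -- Tilting the slope by less than this radius changes the plane by less than the gap `a - (u x +
  -- δ)` on all of `closure Ω`.
  have hη : 0 < (a - (u x + δ)) / (|D| + 1) := div_pos (by linarith) (by positivity)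
  refine (Metric.measure_ball_pos volume q₀ hη).trans_le (measure_mono fun q hq => ?_)
  obtain ⟨y, hy, hlt, hqy⟩ := exists_mem_subdifferential_of_affine_lt (w := v) (q := q) ho hb hu
    hf hδ hx (fun y hy => by
      have h1 : l y + c ≤ v y := hl ⟨y, hy⟩
      have h2 : inner ℝ q₀ (y - x) = l y - l x := by
        rw [InnerProductSpace.toDual_symm_apply, map_sub]
      have hlx' : l x + c = a := hlx
      have h3 : inner ℝ (q - q₀) (y - x) ≤ ‖q - q₀‖ * ‖y - x‖ := real_inner_le_norm _ _
      have h4 : ‖q - q₀‖ < (a - (u x + δ)) / (|D| + 1) := by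
        rw [← dist_eq_norm]; exact hq
      have h5 : ‖y - x‖ < |D| + 1 := by
        have := hD hy
        rw [Metric.mem_closedBall, dist_eq_norm] at this
        linarith [le_abs_self D]
      have h6 : ‖q - q₀‖ * ‖y - x‖ < a - (u x + δ) := by
        calc ‖q - q₀‖ * ‖y - x‖ ≤ ‖q - q₀‖ * (|D| + 1) := by gcongr
          _ < (a - (u x + δ)) / (|D| + 1) * (|D| + 1) := by gcongr
          _ = _ := div_mul_cancel₀ _ (by positivity)
      rw [inner_sub_left, h2] at h3
      linarith)
  exact mem_iUnion₂.2 ⟨y, ⟨hy, hlt⟩, hqy⟩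

open Set in
/-- Comparison principle for the Monge–Ampère measure, with a factor less than one. -/
theorem le_of_mongeAmpere_le_mul {n : ℕ} {Ω : Set (EuclideanSpace ℝ (Fin n))}
    (ho : IsOpen Ω) (hb : Bornology.IsBounded Ω) {u v : EuclideanSpace ℝ (Fin n) → ℝ}
    (hu : ContinuousOn u (closure Ω)) (hv : ContinuousOn v (closure Ω))
    (hvc : ConvexOn ℝ (closure Ω) v) {θ : ENNReal} (hθ : θ < 1)
    (h : ∀ S, MeasurableSet S → S ⊆ Ω → mongeAmpere Ω u S ≤ θ * mongeAmpere Ω v S)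
    (hf : ∀ y ∈ frontier Ω, v y ≤ u y) : ∀ x ∈ Ω, v x ≤ u x := by
  intro x hx
  by_contra! hlt
  -- A strictly positive `δ` keeps `U` inside a compact subset of `Ω`, so that `μ_u(U)` is finite
  -- and can be cancelled.
  obtain ⟨δ, hδ, hδx⟩ : ∃ δ, 0 < δ ∧ u x + δ < v x :=
    ⟨(v x - u x) / 2, by linarith, by linarith⟩
  set U := {y ∈ Ω | u y + δ < v y}
  have hU : IsOpen U := by
    have h1 : ContinuousOn (fun y => v y - u y) Ω := (hv.sub hu).mono subset_closure
    have h2 : U = Ω ∩ (fun y => v y - u y) ⁻¹' Ioi δ := by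
      ext y; simp only [U, mem_ofPred_eq, mem_inter_iff, mem_preimage, mem_Ioi]
      refine and_congr_right fun _ => ⟨fun _ => by linarith, fun _ => by linarith⟩
    rw [h2]
    exact h1.isOpen_inter_preimage ho isOpen_Ioi
  have hK : IsCompact (closure Ω ∩ (fun y => v y - u y) ⁻¹' Ici δ) :=
    hb.isCompact_closure.of_isClosed_subset
      ((hv.sub hu).preimage_isClosed_of_isClosed isClosed_closure isClosed_Ici) inter_subset_left
  have hfin : mongeAmpere Ω u U < ⊤ := by
    refine mongeAmpere_lt_top ho hb hu hK (fun y hy => ?_) (fun y hy => ?_)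
    · by_contra hn
      have h1 := hf y (by rw [ho.frontier_eq]; exact ⟨hy.1, hn⟩)
      have h2 : δ ≤ v y - u y := hy.2
      linarith
    · have h1 := hy.2
      refine ⟨subset_closure hy.1, ?_⟩
      change δ ≤ v y - u y
      linarith
  have hpos : 0 < mongeAmpere Ω u U := mongeAmpere_pos_of_lt ho hb hu hv hvc hf hδ.le hx hδx
  have hle : mongeAmpere Ω v U ≤ mongeAmpere Ω u U := by
    refine measure_mono (iUnion₂_subset fun y hy q hq => ?_)
    obtain ⟨z, hz, hzlt, hqz⟩ := exists_mem_subdifferential_of_affine_lt (w := v) ho hb hu hf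
      hδ.le hy.1 (q := q) (fun z hz => by
        have := subdifferential_le_of_mem_closure hv hq hz
        linarith [hy.2])
    exact mem_iUnion₂.2 ⟨z, ⟨hz, hzlt⟩, hqz⟩
  have h1 : mongeAmpere Ω u U ≤ θ * mongeAmpere Ω u U :=
    (h U hU.measurableSet fun y hy => hy.1).trans (by gcongr)
  have h2 : θ * mongeAmpere Ω u U < 1 * mongeAmpere Ω u U :=
    (ENNReal.mul_lt_mul_iff_left hpos.ne' hfin.ne).2 hθ
  rw [one_mul] at h2
  exact absurd h1 h2.not_ge

/-! ### Scaling of the Monge–Ampère measure -/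

open Set Pointwise in
lemma mongeAmpere_const_mul {n : ℕ} (Ω : Set (EuclideanSpace ℝ (Fin n)))
    (v : EuclideanSpace ℝ (Fin n) → ℝ) {s : ℝ} (hs : 0 < s)
    (S : Set (EuclideanSpace ℝ (Fin n))) :
    mongeAmpere Ω (fun x => s * v x) S = ENNReal.ofReal (s ^ n) * mongeAmpere Ω v S := by
  have h1 : ⋃ x ∈ S, subdifferential Ω (fun x => s * v x) x
      = s • ⋃ x ∈ S, subdifferential Ω v x := by
    rw [smul_set_iUnion₂]
    refine iUnion₂_congr fun x _ => ?_
    ext q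
    rw [mem_smul_set_iff_inv_smul_mem₀ hs.ne']
    refine forall₂_congr fun y _ => ?_
    rw [real_inner_smul_left, ← mul_le_mul_iff_right₀ hs (b := v x + _), mul_add,
      mul_inv_cancel_left₀ hs.ne']
  rw [mongeAmpere, h1, Measure.addHaar_smul, finrank_euclideanSpace, Fintype.card_fin,
    abs_of_pos (by positivity), mongeAmpere]

-- By the chain rule, composing with a homothety of ratio `r` multiplies every subgradient by `r`,
-- hence volumes of slopes by `r ^ n`.
open Set Pointwise in
lemma mongeAmpere_comp_homothety {n : ℕ} (Ω : Set (EuclideanSpace ℝ (Fin n)))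
    (u : EuclideanSpace ℝ (Fin n) → ℝ) (x₀ : EuclideanSpace ℝ (Fin n)) {r : ℝ} (hr : 0 < r)
    (S : Set (EuclideanSpace ℝ (Fin n))) :
    mongeAmpere ((fun x => x₀ + r • (x - x₀)) ⁻¹' Ω) (fun x => u (x₀ + r • (x - x₀))) S
      = ENNReal.ofReal (r ^ n) * mongeAmpere Ω u ((fun x => x₀ + r • (x - x₀)) '' S) := by
  have h1 : ⋃ x ∈ S, subdifferential ((fun x => x₀ + r • (x - x₀)) ⁻¹' Ω)
        (fun x => u (x₀ + r • (x - x₀))) x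
      = r • ⋃ y ∈ (fun x => x₀ + r • (x - x₀)) '' S, subdifferential Ω u y := by
    rw [biUnion_image, smul_set_iUnion₂]
    refine iUnion₂_congr fun x _ => ?_
    ext q
    rw [mem_smul_set_iff_inv_smul_mem₀ hr.ne']
    have key : ∀ y, inner ℝ (r⁻¹ • q) (x₀ + r • (y - x₀) - (x₀ + r • (x - x₀)))
        = inner ℝ q (y - x) := by
      intro y
      rw [show x₀ + r • (y - x₀) - (x₀ + r • (x - x₀)) = r • (y - x) by module,
        real_inner_smul_left, real_inner_smul_right, inv_mul_cancel_left₀ hr.ne']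
    constructor
    · intro h y hy
      have h2 := h (x₀ + r⁻¹ • (y - x₀)) (by
        simpa [smul_smul, mul_inv_cancel₀ hr.ne'] using hy)
      rw [← key] at h2
      simpa [smul_smul, mul_inv_cancel₀ hr.ne'] using h2
    · intro h y hy
      have h2 := h _ hy
      rwa [key] at h2
  rw [mongeAmpere, h1, Measure.addHaar_smul, finrank_euclideanSpace, Fintype.card_fin,
    abs_of_pos (by positivity), mongeAmpere]

/-! ### Improving the comparison factor -/

/-- If `t v ≤ u` holds `ν`-almost everywhere, then the factor `t` improves to `s` everywhere. -/
lemma mul_le_of_ae_mul_le {n : ℕ} {p A t s : ℝ} {Ω : Set (EuclideanSpace ℝ (Fin n))}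
    (ho : IsOpen Ω) (hb : Bornology.IsBounded Ω) {ν : Measure (EuclideanSpace ℝ (Fin n))}
    {u v : EuclideanSpace ℝ (Fin n) → ℝ} (hp : 0 ≤ p)
    (hu : ContinuousOn u (closure Ω)) (hv : ContinuousOn v (closure Ω))
    (hvc : ConvexOn ℝ (closure Ω) v) (hA : 0 ≤ A)
    (hsuper : ∀ S, MeasurableSet S → S ⊆ Ω →
      mongeAmpere Ω u S ≤ ENNReal.ofReal A * powMeasure ν p u S)
    (hsub : BorelLE Ω (powMeasure ν p v) (mongeAmpere Ω v))
    (hu0 : ∀ x ∈ Ω, u x ≤ 0) (hvf : ∀ x ∈ frontier Ω, v x ≤ 0) (huf : ∀ x ∈ frontier Ω, u x = 0)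
    (ht : 0 < t) (hs : 0 < s) (hts : A * t ^ p < s ^ n)
    (hae : ∀ᵐ x ∂ν.restrict Ω, t * v x ≤ u x) : ∀ x ∈ Ω, s * v x ≤ u x := by
  have hsn : 0 < s ^ n := by positivity
  refine le_of_mongeAmpere_le_mul ho hb hu (v := fun x => s * v x) (continuousOn_const.mul hv)
    (by simpa using hvc.smul hs.le) (θ := ENNReal.ofReal (A * t ^ p / s ^ n)) ?_
    (fun S hS hSΩ => ?_) fun x hx => ?_
  · rw [ENNReal.ofReal_lt_one, div_lt_one hsn]
    exact hts
  · have h1 : powMeasure ν p u S ≤ ENNReal.ofReal (t ^ p) * powMeasure ν p v S := by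
      rw [powMeasure, powMeasure, ← lintegral_const_mul' _ _ ENNReal.ofReal_ne_top]
      refine lintegral_mono_ae ?_
      filter_upwards [ae_restrict_of_ae_restrict_of_subset hSΩ hae, ae_restrict_mem hS]
        with x hx hxS
      rw [← ENNReal.ofReal_mul (by positivity), ← Real.mul_rpow ht.le (abs_nonneg _)]
      refine ENNReal.ofReal_le_ofReal (Real.rpow_le_rpow (abs_nonneg _) ?_ hp)
      rw [abs_of_nonpos (hu0 x (hSΩ hxS))]
      have : t * -v x ≤ t * |v x| := by gcongr; exact neg_le_abs _
      linarith
    calc mongeAmpere Ω u S ≤ ENNReal.ofReal A * (ENNReal.ofReal (t ^ p) * mongeAmpere Ω v S) :=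
          (hsuper S hS hSΩ).trans (by gcongr; exact h1.trans (by gcongr; exact hsub S hS hSΩ))
      _ = ENNReal.ofReal (A * t ^ p / s ^ n) * mongeAmpere Ω (fun x => s * v x) S := by
          rw [mongeAmpere_const_mul _ _ hs, ← mul_assoc, ← mul_assoc, ← ENNReal.ofReal_mul hA,
            ← ENNReal.ofReal_mul (by positivity), div_mul_cancel₀ _ hsn.ne']
  · rw [huf x hx]
    exact mul_nonpos_of_nonneg_of_nonpos hs.le (hvf x hx)

open Set Filter Topology in
/-- Comparison of a sub- and a supersolution, up to the factor that the constant `A` allows, as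
soon as they are comparable at all. -/
lemma mul_le_of_exists_ae_mul_le {n : ℕ} {p A τ : ℝ} {Ω : Set (EuclideanSpace ℝ (Fin n))}
    (ho : IsOpen Ω) (hb : Bornology.IsBounded Ω) {ν : Measure (EuclideanSpace ℝ (Fin n))}
    {u v : EuclideanSpace ℝ (Fin n) → ℝ} (hp : 0 < p) (hpn : p < n)
    (hu : ContinuousOn u (closure Ω)) (hv : ContinuousOn v (closure Ω))
    (hvc : ConvexOn ℝ (closure Ω) v) (hA : 0 ≤ A)
    (hsuper : ∀ S, MeasurableSet S → S ⊆ Ω →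
      mongeAmpere Ω u S ≤ ENNReal.ofReal A * powMeasure ν p u S)
    (hsub : BorelLE Ω (powMeasure ν p v) (mongeAmpere Ω v))
    (hu0 : ∀ x ∈ Ω, u x ≤ 0) (hvf : ∀ x ∈ frontier Ω, v x ≤ 0) (huf : ∀ x ∈ frontier Ω, u x = 0)
    (hτ : 0 < τ) (hAτ : A < τ ^ (n - p))
    (hae : ∃ t, 0 < t ∧ ∀ᵐ x ∂ν.restrict Ω, t * v x ≤ u x) : ∀ x ∈ Ω, τ * v x ≤ u x := by
  have hn : n ≠ 0 := by rintro rfl; norm_num at hpn; linarith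
  have step : ∀ t s, 0 < t → 0 < s → A * t ^ p < s ^ n →
      (∀ᵐ x ∂ν.restrict Ω, t * v x ≤ u x) → ∀ x ∈ Ω, s * v x ≤ u x :=
    fun t s => mul_le_of_ae_mul_le ho hb hp.le hu hv hvc hA hsuper hsub hu0 hvf huf
  set T := {t : ℝ | τ ≤ t ∧ ∀ x ∈ Ω, t * v x ≤ u x}
  have hT : T.Nonempty := by
    obtain ⟨t, ht, hta⟩ := hae
    obtain ⟨s, hs1, hs2⟩ := (((tendsto_pow_atTop hn).eventually_gt_atTop (A * t ^ p)).and
      (eventually_ge_atTop τ)).exists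
    exact ⟨s, hs2, step t s ht (hτ.trans_le hs2) hs1 hta⟩
  have hTc : IsClosed T := by
    have : T = Ici τ ∩ ⋂ x ∈ Ω, {t : ℝ | t * v x ≤ u x} := by ext; simp [T]
    rw [this]
    exact isClosed_Ici.inter (isClosed_biInter fun x _ => isClosed_le (by fun_prop) (by fun_prop))
  have hTb : BddBelow T := ⟨τ, fun t ht => ht.1⟩
  have hm : sInf T ∈ T := hTc.csInf_mem hT hTb
  set m := sInf T
  rcases hm.1.eq_or_lt with h | h
  · rw [h]; exact hm.2
  exfalso
  have hm0 : 0 < m := hτ.trans h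
  -- Since `p < n`, the condition on `τ` persists at `m > τ` and leaves room for some `s < m` in
  -- `T`, against minimality.
  have h1 : A * m ^ p < m ^ n := by
    calc A * m ^ p < τ ^ (n - p) * m ^ p := by gcongr
      _ ≤ m ^ (n - p) * m ^ p := by gcongr
      _ = m ^ n := by rw [← Real.rpow_add hm0, sub_add_cancel, Real.rpow_natCast]
  have h2 : ∀ᶠ s in 𝓝[<] m, A * m ^ p < s ^ n :=
    ((continuous_pow n).continuousAt.eventually_const_lt h1).filter_mono nhdsWithin_le_nhds
  obtain ⟨s, hs1, hs2⟩ := (h2.and (Ioo_mem_nhdsLT h)).exists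
  have hsT : s ∈ T := ⟨hs2.1.le, step m s hm0 (hτ.trans hs2.1) hs1 (by
    filter_upwards [ae_restrict_mem ho.measurableSet] with x hx using hm.2 x hx)⟩
  exact absurd (csInf_le hTb hsT) hs2.2.not_ge

open Filter Topology in
lemma le_of_forall_one_lt_mul_le {a b : ℝ} (h : ∀ τ > 1, τ * a ≤ b) : a ≤ b := by
  have h1 : Tendsto (fun τ : ℝ => τ * a) (𝓝[>] 1) (𝓝 (1 * a)) :=
    ((continuous_id.mul continuous_const).tendsto 1).mono_left nhdsWithin_le_nhds
  rw [one_mul] at h1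
  exact le_of_tendsto h1 (by filter_upwards [self_mem_nhdsWithin] with τ hτ using h τ hτ)

/-- Two continuous functions, one of them negative, are comparable on a compact set. -/
lemma exists_mul_le_of_isCompact {n : ℕ} {K : Set (EuclideanSpace ℝ (Fin n))} (hK : IsCompact K)
    {u v : EuclideanSpace ℝ (Fin n) → ℝ} (hu : ContinuousOn u K) (hv : ContinuousOn v K)
    (hneg : ∀ x ∈ K, v x < 0) : ∃ t, 0 < t ∧ ∀ x ∈ K, t * v x ≤ u x := by
  obtain ⟨M, hM⟩ := hK.exists_bound_of_continuousOn (hu.div hv fun x hx => (hneg x hx).ne)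
  refine ⟨|M| + 1, by positivity, fun x hx => ?_⟩
  rw [← div_le_iff_of_neg (hneg x hx)]
  have h1 : u x / v x ≤ M := (le_abs_self _).trans (hM x hx)
  linarith [le_abs_self M]

/-! ### Contracted supersolutions for a continuous density -/

lemma powMeasure_eq_setLIntegral {n : ℕ} {Ω : Set (EuclideanSpace ℝ (Fin n))} (ho : IsOpen Ω)
    {ν : Measure (EuclideanSpace ℝ (Fin n))} {f : EuclideanSpace ℝ (Fin n) → ℝ}
    (hf : ContinuousOn f (closure Ω))
    (hν : ν.restrict Ω = (volume.restrict Ω).withDensity fun x => ENNReal.ofReal (f x))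
    (p : ℝ) (u : EuclideanSpace ℝ (Fin n) → ℝ) {S : Set (EuclideanSpace ℝ (Fin n))}
    (hS : MeasurableSet S) (hSΩ : S ⊆ Ω) :
    powMeasure ν p u S = ∫⁻ x in S, ENNReal.ofReal (f x) * ENNReal.ofReal (|u x| ^ p) := by
  have h1 : ν.restrict S = (ν.restrict Ω).restrict S := by
    rw [Measure.restrict_restrict hS, Set.inter_eq_left.2 hSΩ]
  have h2 : (volume.restrict Ω).restrict S = volume.restrict S := by
    rw [Measure.restrict_restrict hS, Set.inter_eq_left.2 hSΩ]
  have h3 : AEMeasurable f (volume.restrict S) :=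
    ((hf.mono subset_closure).aemeasurable ho.measurableSet).mono_measure
      (Measure.restrict_mono hSΩ le_rfl)
  rw [powMeasure, h1, hν, setLIntegral_withDensity_eq_setLIntegral_mul_non_measurable₀ _
    (by rw [h2]; exact h3.ennreal_ofReal) _ hS (by simp), h2]
  rfl

lemma setLIntegral_image_homothety {n : ℕ} (x₀ : EuclideanSpace ℝ (Fin n)) {r : ℝ} (hr : 0 < r)
    {S : Set (EuclideanSpace ℝ (Fin n))} (hS : MeasurableSet S)
    (g : EuclideanSpace ℝ (Fin n) → ENNReal) :
    ∫⁻ y in (fun x => x₀ + r • (x - x₀)) '' S, g y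
      = ENNReal.ofReal (r ^ n) * ∫⁻ x in S, g (x₀ + r • (x - x₀)) := by
  rw [lintegral_image_eq_lintegral_abs_det_fderiv_mul volume hS
    (f := fun x => x₀ + r • (x - x₀))
    (f' := fun _ => r • ContinuousLinearMap.id ℝ (EuclideanSpace ℝ (Fin n)))
    (fun x _ => ((((hasFDerivAt_id x).sub_const x₀).const_smul r).const_add x₀).hasFDerivWithinAt)
    (fun x _ y _ h => by simpa [hr.ne'] using h),
    ← lintegral_const_mul' _ _ ENNReal.ofReal_ne_top]
  simp [ContinuousLinearMap.det, abs_of_pos hr]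

/-- A supersolution with a continuous density stays one, up to a factor, when it is contracted. -/
lemma mongeAmpere_comp_homothety_le {n : ℕ} {p B r : ℝ} {Ω S : Set (EuclideanSpace ℝ (Fin n))}
    (ho : IsOpen Ω) {ν : Measure (EuclideanSpace ℝ (Fin n))}
    {f u : EuclideanSpace ℝ (Fin n) → ℝ} (hf : ContinuousOn f (closure Ω))
    (hν : ν.restrict Ω = (volume.restrict Ω).withDensity fun x => ENNReal.ofReal (f x))
    (hsuper : BorelLE Ω (mongeAmpere Ω u) (powMeasure ν p u))
    {x₀ : EuclideanSpace ℝ (Fin n)} (hr : 0 < r) (hB : 0 ≤ B)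
    (hrΩ : (fun x => x₀ + r • (x - x₀)) ⁻¹' Ω ⊆ Ω)
    (hfB : ∀ x, x₀ + r • (x - x₀) ∈ Ω → f (x₀ + r • (x - x₀)) ≤ B * f x)
    (hS : MeasurableSet S) (hSΩ : S ⊆ (fun x => x₀ + r • (x - x₀)) ⁻¹' Ω) :
    mongeAmpere ((fun x => x₀ + r • (x - x₀)) ⁻¹' Ω) (fun x => u (x₀ + r • (x - x₀))) S
      ≤ ENNReal.ofReal (r ^ n * (r ^ n * B)) *
        powMeasure ν p (fun x => u (x₀ + r • (x - x₀))) S := by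
  have hSm : MeasurableSet ((fun x => x₀ + r • (x - x₀)) '' S) := by
    refine hS.image_of_continuousOn_injOn (by fun_prop) (fun x _ y _ h => ?_)
    simpa [hr.ne'] using h
  have hSi : (fun x => x₀ + r • (x - x₀)) '' S ⊆ Ω := Set.image_subset_iff.2 hSΩ
  -- One `r ^ n` comes from the slopes, the other from the change of variables in the integral.
  rw [mongeAmpere_comp_homothety _ _ _ hr, ENNReal.ofReal_mul (by positivity), mul_assoc]
  gcongr
  refine (hsuper _ hSm hSi).trans ?_
  rw [powMeasure_eq_setLIntegral ho hf hν p u hSm hSi, setLIntegral_image_homothety x₀ hr hS,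
    powMeasure_eq_setLIntegral ho hf hν p _ hS (hSΩ.trans hrΩ), ENNReal.ofReal_mul (by positivity),
    mul_assoc]
  gcongr
  rw [← lintegral_const_mul' _ _ ENNReal.ofReal_ne_top]
  refine setLIntegral_mono' hS fun x hx => ?_
  rw [← mul_assoc, ← ENNReal.ofReal_mul hB]
  gcongr
  exact hfB x (hSΩ hx)

open Set in
lemma closure_preimage_homothety_subset {n : ℕ} {Ω : Set (EuclideanSpace ℝ (Fin n))}
    (ho : IsOpen Ω) (hc : Convex ℝ Ω) {x₀ : EuclideanSpace ℝ (Fin n)} (hx₀ : x₀ ∈ Ω) {r : ℝ}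
    (hr : 1 < r) : closure ((fun x => x₀ + r • (x - x₀)) ⁻¹' Ω) ⊆ Ω := by
  intro x hx
  have h1 : x₀ + r • (x - x₀) ∈ closure Ω :=
    (by fun_prop : Continuous fun x => x₀ + r • (x - x₀)).closure_preimage_subset Ω hx
  have hr0 : 0 < r := by linarith
  -- `x` lies strictly between the interior point `x₀` and its image in `closure Ω`, hence in the
  -- interior.
  have h2 := hc.combo_interior_closure_mem_interior (by rwa [ho.interior_eq] : x₀ ∈ interior Ω) h1
    (a := 1 - r⁻¹) (b := r⁻¹) (sub_pos.2 (inv_lt_one_of_one_lt₀ hr)) (by positivity) (by ring)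
  rw [ho.interior_eq, smul_add, smul_smul, inv_mul_cancel₀ hr0.ne'] at h2
  convert h2 using 1
  module

open Filter Topology in
/-- A positive continuous function on a compact set has small relative oscillation under
homotheties close to the identity. -/
lemma eventually_homothety_le_mul {n : ℕ} {Ω : Set (EuclideanSpace ℝ (Fin n))}
    (hb : Bornology.IsBounded Ω) {f : EuclideanSpace ℝ (Fin n) → ℝ}
    (hf : ContinuousOn f (closure Ω)) (hf0 : ∀ x ∈ closure Ω, 0 < f x)
    {x₀ : EuclideanSpace ℝ (Fin n)} (hx₀ : x₀ ∈ Ω) {B : ℝ} (hB : 1 < B) :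
    ∀ᶠ r in 𝓝 (1 : ℝ), ∀ x ∈ Ω, x₀ + r • (x - x₀) ∈ Ω → f (x₀ + r • (x - x₀)) ≤ B * f x := by
  obtain ⟨z, hz, hmin⟩ := hb.isCompact_closure.exists_isMinOn ⟨x₀, subset_closure hx₀⟩ hf
  have hmin' : ∀ y ∈ closure Ω, f z ≤ f y := hmin
  have huc := hb.isCompact_closure.uniformContinuousOn_of_continuous hf
  rw [Metric.uniformContinuousOn_iff] at huc
  -- The positive minimum `f z` turns an additive error into a relative one.
  obtain ⟨d, hd, hdf⟩ := huc ((B - 1) * f z) (mul_pos (by linarith) (hf0 z hz))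
  obtain ⟨D, hD⟩ := hb.subset_closedBall x₀
  have hlim : Tendsto (fun r : ℝ => |r - 1| * D) (𝓝 1) (𝓝 (|1 - 1| * D)) :=
    Continuous.tendsto (by fun_prop) 1
  rw [sub_self, abs_zero, zero_mul] at hlim
  filter_upwards [hlim.eventually_lt_const hd] with r hr x hx hrx
  have h1 : dist (x₀ + r • (x - x₀)) x < d := by
    rw [dist_eq_norm, show x₀ + r • (x - x₀) - x = (r - 1) • (x - x₀) by module, norm_smul,
      Real.norm_eq_abs]
    refine lt_of_le_of_lt ?_ hr
    gcongr
    rw [← dist_eq_norm]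
    exact hD hx
  have h2 := hdf _ (subset_closure hrx) _ (subset_closure hx) h1
  rw [Real.dist_eq] at h2
  have h3 := (abs_lt.1 h2).2
  have h4 := mul_le_mul_of_nonneg_left (hmin' x (subset_closure hx)) (by linarith : 0 ≤ B - 1)
  linarith

/-! ### The two cases and the conclusion -/

open Set Filter Topology in
theorem le_of_hasPositiveContinuousDensity {n : ℕ} {p : ℝ} (hp : 0 < p) (hpn : p < n)
    {Ω : Set (EuclideanSpace ℝ (Fin n))} (ho : IsOpen Ω) (hc : Convex ℝ Ω)
    (hb : Bornology.IsBounded Ω) {ν : Measure (EuclideanSpace ℝ (Fin n))}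
    (hν : HasPositiveContinuousDensity Ω ν) {u v : EuclideanSpace ℝ (Fin n) → ℝ}
    (hu : ContinuousOn u (closure Ω)) (hv : ContinuousOn v (closure Ω))
    (hvc : ConvexOn ℝ Ω v) (hneg : ∀ x ∈ Ω, v x < 0)
    (hsub : BorelLE Ω (powMeasure ν p v) (mongeAmpere Ω v))
    (hu0 : ∀ x ∈ Ω, u x ≤ 0) (huf : ∀ x ∈ frontier Ω, u x = 0)
    (hsuper : BorelLE Ω (mongeAmpere Ω u) (powMeasure ν p u)) : ∀ x ∈ Ω, v x ≤ u x := by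
  obtain ⟨f, hf, hf0, hνf⟩ := hν
  intro x₀ hx₀
  refine le_of_forall_one_lt_mul_le fun τ hτ => ?_
  obtain ⟨B, hB1, hBτ⟩ := exists_between (Real.one_lt_rpow hτ (sub_pos.2 hpn))
  have hlim : Tendsto (fun r : ℝ => r ^ n * (r ^ n * B)) (𝓝 1) (𝓝 (1 ^ n * (1 ^ n * B))) :=
    Continuous.tendsto (by fun_prop) 1
  rw [one_pow, one_mul, one_mul] at hlim
  obtain ⟨r, ⟨hrτ, hrf⟩, hr⟩ := ((((hlim.eventually_lt_const hBτ).and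
    (eventually_homothety_le_mul hb hf hf0 hx₀ hB1)).filter_mono nhdsWithin_le_nhds).and
    (self_mem_nhdsWithin (s := Ioi (1 : ℝ)))).exists
  have hr0 : 0 < r := zero_lt_one.trans hr
  have hG : Continuous fun x => x₀ + r • (x - x₀) := by fun_prop
  have hcl := closure_preimage_homothety_subset ho hc hx₀ hr
  have hsubset := subset_closure.trans hcl
  have hbr : Bornology.IsBounded ((fun x => x₀ + r • (x - x₀)) ⁻¹' Ω) := hb.subset hsubset
  have huG : ContinuousOn (fun x => u (x₀ + r • (x - x₀)))
      (closure ((fun x => x₀ + r • (x - x₀)) ⁻¹' Ω)) :=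
    hu.comp hG.continuousOn fun x hx => hG.closure_preimage_subset Ω hx
  have hvG := hv.mono (hcl.trans subset_closure)
  have hGc : Convex ℝ ((fun x => x₀ + r • (x - x₀)) ⁻¹' Ω) := by
    intro x hx y hy a b ha hb hab
    have := hc hx hy ha hb hab
    change x₀ + r • (a • x + b • y - x₀) ∈ Ω
    convert this using 1
    obtain rfl : b = 1 - a := by linarith
    module
  obtain ⟨t, ht, htK⟩ := exists_mul_le_of_isCompact hbr.isCompact_closure huG hvG
    fun x hx => hneg x (hcl hx)
  have := mul_le_of_exists_ae_mul_le (ho.preimage hG) hbr hp hpn huG hvG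
    (hvc.subset hcl hGc.closure) (A := r ^ n * (r ^ n * B)) (by positivity)
    (fun S hS hSΩ => mongeAmpere_comp_homothety_le ho hf hνf hsuper hr0 (by linarith) hsubset
      (fun x hx => hrf x (hsubset hx) hx) hS hSΩ)
    -- Shrinking the domain only enlarges subdifferentials, so `v` remains a subsolution.
    (fun S hS hSΩ => (hsub S hS (hSΩ.trans hsubset)).trans (measure_mono
      (iUnion₂_mono fun x _ q hq y hy => hq y (hsubset hy))))
    (fun x hx => hu0 _ hx) (fun x hx => (hneg x (hcl (frontier_subset_closure hx))).le)
    (fun x hx => huf _ (hG.frontier_preimage_subset Ω hx)) (zero_lt_one.trans hτ) hrτ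
    ⟨t, ht, by
      filter_upwards [ae_restrict_mem (ho.preimage hG).measurableSet] with x hx
        using htK x (subset_closure hx)⟩
    x₀ (by simpa using hx₀)
  simpa using this

theorem le_of_isCompactlySupportedIn {n : ℕ} {p : ℝ} (hp : 0 < p) (hpn : p < n)
    {Ω : Set (EuclideanSpace ℝ (Fin n))} (ho : IsOpen Ω)
    (hb : Bornology.IsBounded Ω) {ν : Measure (EuclideanSpace ℝ (Fin n))}
    (hν : IsCompactlySupportedIn Ω ν) {u v : EuclideanSpace ℝ (Fin n) → ℝ}
    (hu : ContinuousOn u (closure Ω)) (hv : ContinuousOn v (closure Ω))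
    (hvc : ConvexOn ℝ (closure Ω) v) (hneg : ∀ x ∈ Ω, v x < 0) (hvf : ∀ x ∈ frontier Ω, v x ≤ 0)
    (hsub : BorelLE Ω (powMeasure ν p v) (mongeAmpere Ω v))
    (hu0 : ∀ x ∈ Ω, u x ≤ 0) (huf : ∀ x ∈ frontier Ω, u x = 0)
    (hsuper : BorelLE Ω (mongeAmpere Ω u) (powMeasure ν p u)) : ∀ x ∈ Ω, v x ≤ u x := by
  obtain ⟨K, hK, hKΩ, hνK⟩ := hν
  obtain ⟨t, ht, htK⟩ := exists_mul_le_of_isCompact hK (hu.mono (hKΩ.trans subset_closure))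
    (hv.mono (hKΩ.trans subset_closure)) fun x hx => hneg x (hKΩ hx)
  refine fun x hx => le_of_forall_one_lt_mul_le fun τ hτ => ?_
  refine mul_le_of_exists_ae_mul_le ho hb hp hpn hu hv hvc zero_le_one
    (fun S hS hSΩ => by simpa using hsuper S hS hSΩ) hsub hu0 hvf huf (zero_lt_one.trans hτ)
    (Real.one_lt_rpow hτ (sub_pos.2 hpn)) ⟨t, ht, ?_⟩ x hx
  rw [ae_restrict_iff' ho.measurableSet, ae_iff]
  refine measure_mono_null (fun y hy => ?_) hνK
  simp only [Set.mem_ofPred_eq, not_forall] at hy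
  exact ⟨hy.1, fun hyK => hy.2 (htK y hyK)⟩

theorem theorem1p5 (n : ℕ) (p : ℝ) (hp0 : 0 < p) (hpn : p < n)
    (Ω : Set (EuclideanSpace ℝ (Fin n)))
    (hΩ_open : IsOpen Ω) (hΩ_conv : Convex ℝ Ω) (hΩ_bdd : Bornology.IsBounded Ω)
    (ν : Measure (EuclideanSpace ℝ (Fin n)))
    (hν : HasPositiveContinuousDensity Ω ν ∨ IsCompactlySupportedIn Ω ν)
    (u v : EuclideanSpace ℝ (Fin n) → ℝ)
    (hu_cont : ContinuousOn u (closure Ω)) (hu_conv : ConvexOn ℝ Ω u)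
    (hv_cont : ContinuousOn v (closure Ω)) (hv_conv : ConvexOn ℝ Ω v)
    (hv_neg : ∀ x ∈ Ω, v x < 0) (hv_bdry : ∀ x ∈ frontier Ω, v x ≤ 0)
    (hv_sub : BorelLE Ω (powMeasure ν p v) (mongeAmpere Ω v))
    (hu_bdry : ∀ x ∈ frontier Ω, u x = 0)
    (hu_super : BorelLE Ω (mongeAmpere Ω u) (powMeasure ν p u)) :
    (∀ x ∈ Ω, v x ≤ u x) ∧ BorelLE Ω (mongeAmpere Ω u) (mongeAmpere Ω v) := by
  have hu0 : ∀ x ∈ Ω, u x ≤ 0 :=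
    (hu_conv.closure_of_continuousOn hu_cont).nonpos_of_frontier
      (by rintro rfl; norm_num at hpn; linarith) hΩ_open hΩ_bdd hu_bdry
  have hvu : ∀ x ∈ Ω, v x ≤ u x := by
    rcases hν with hν | hν
    · exact le_of_hasPositiveContinuousDensity hp0 hpn hΩ_open hΩ_conv hΩ_bdd hν hu_cont hv_cont
        hv_conv hv_neg hv_sub hu0 hu_bdry hu_super
    · exact le_of_isCompactlySupportedIn hp0 hpn hΩ_open hΩ_bdd hν hu_cont hv_cont
        (hv_conv.closure_of_continuousOn hv_cont) hv_neg hv_bdry hv_sub hu0 hu_bdry hu_super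
  -- Both functions are nonpositive, so `v ≤ u` means `|u| ≤ |v|`, and the measures chain as `μ_u ≤
  -- |u|^p ν ≤ |v|^p ν ≤ μ_v`.
  refine ⟨hvu, fun S hS hSΩ => (hu_super S hS hSΩ).trans (le_trans ?_ (hv_sub S hS hSΩ))⟩
  refine setLIntegral_mono' hS fun x hx => ENNReal.ofReal_le_ofReal
    (Real.rpow_le_rpow (abs_nonneg _) ?_ hp0.le)
  rw [abs_of_nonpos (hu0 x (hSΩ hx)), abs_of_neg (hv_neg x (hSΩ hx))]
  exact neg_le_neg (hvu x (hSΩ hx))
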